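/- Let $S^d$ be the unit sphere of $\mathbb{R}^{d+1}$ with center the origin $\mathbf{o}$. A spherical simplex is given by linearly independent unit vectors, its vertices; ordered simplices that differ by a permutation of the vertices are identified up to the sign of the permutation. A $d$-dimensional simplicial chain $\mathcal{C}=\sum_i a_i\Delta_i$ in $S^d$ is a finite combination, with coefficients $a_i\in\mathbb{Z}$, of oriented spherical $d$-simplices $\Delta_i=\mathbf{v}_0\mathbf{v}_1\dots\mathbf{v}_d$; it is a cycle if $\partial\mathcal{C}=0$, where $\partial(\mathbf{v}_0\dots\mathbf{v}_d)=\sum_{j=0}^d(-1)^j\,\mathbf{v}_0\dots\widehat{\mathbf{v}_j}\dots\mathbf{v}_d$ (for $d=0$, $\partial$ is the augmentation, so a cycle is a chain with $\sum_i a_i=0$). For each $\Delta_i$ let $\Delta_i'=\mathbf{o}\mathbf{v}_0\mathbf{v}_1\dots\mathbf{v}_d$ be the cone over it in $\mathbb{R}^{d+1}$, let $\mathbf{o}_i'$ be the circumcenter of $\Delta_i'$ (it is nonzero), and let $\mathrm{Vol}(\Delta_i')$ be its oriented volume, i.e. its $(d+1)$-dimensional volume with the sign of $\det(\mathbf{v}_0,\dots,\mathbf{v}_d)$.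 A weighted point $(\mathbf{x},m)$ is interpreted as the vector $m\mathbf{x}\in\mathbb{R}^{d+1}$; a system of weighted points $(\mathbf{x}_i,m_i)$ has the vector sum $\sum_i m_i\mathbf{x}_i$, whose norm is its total mass (weight). The spherical circumcenter of mass of $\mathcal{C}$ is the vector sum, with multiplicities $a_i$, of the weighted circumcenters $$\left(\frac{\mathbf{o}_i'}{\|\mathbf{o}_i'\|},\ \mathrm{Vol}(\Delta_i')\,\|\mathbf{o}_i'\|\right).$$ If $\mathcal{C}$ is a $d$-dimensional simplicial cycle in $S^d$, then its spherical circumcenter of mass is the origin $\mathbf{o}$, that is, $$\sum_i a_i\,\mathrm{Vol}(\Delta_i')\,\|\mathbf{o}_i'\|\,\frac{\mathbf{o}_i'}{\|\mathbf{o}_i'\|}=\mathbf{0},$$ and it has zero weight. -/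

import Mathlib

noncomputable section

/-- An ordered nondegenerate spherical simplex with `k` vertices (dimension `k - 1`) on the unit
sphere `S^d` of `ℝ^(d+1)`: its vertices are linearly independent unit vectors, so that it is the
radial projection of their convex hull and its cone from the origin is a genuine simplex. -/
@[ext]
structure SphericalSimplex (d k : ℕ) where
  vertex : Fin k → EuclideanSpace ℝ (Fin (d + 1))
  norm_vertex : ∀ i, ‖vertex i‖ = 1
  linearIndependent : LinearIndependent ℝ vertex

namespace SphericalSimplex

variable {d k : ℕ}

/-- The same simplex with its vertices listed in another order. -/
def permute (σ : SphericalSimplex d k) (π : Equiv.Perm (Fin k)) : SphericalSimplex d k where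
  vertex := σ.vertex ∘ π
  norm_vertex i := σ.norm_vertex (π i)
  linearIndependent := σ.linearIndependent.comp π π.injective

/-- The face opposite to the `i`-th vertex. -/
def face (σ : SphericalSimplex d (k + 1)) (i : Fin (k + 1)) : SphericalSimplex d k where
  vertex := σ.vertex ∘ i.succAbove
  norm_vertex j := σ.norm_vertex (i.succAbove j)
  linearIndependent := σ.linearIndependent.comp _ Fin.succAbove_right_injective

/-- The origin together with linearly independent vectors is affinely independent. -/
theorem affineIndependent_cone (σ : SphericalSimplex d k) :
    AffineIndependent ℝ
      (Fin.cons 0 σ.vertex : Fin (k + 1) → EuclideanSpace ℝ (Fin (d + 1))) := by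
  rw [affineIndependent_iff_linearIndependent_vsub ℝ _ (0 : Fin (k + 1))]
  have h := σ.linearIndependent.comp
    (fun x : {x : Fin (k + 1) // x ≠ 0} => x.1.pred x.2)
    (fun x y hxy => Subtype.ext (Fin.pred_inj.1 hxy))
  have e : (fun i : {x : Fin (k + 1) // x ≠ 0} =>
      (Fin.cons 0 σ.vertex : Fin (k + 1) → EuclideanSpace ℝ (Fin (d + 1))) i -ᵥ
        (Fin.cons 0 σ.vertex : Fin (k + 1) → EuclideanSpace ℝ (Fin (d + 1))) 0) =
      σ.vertex ∘ fun x : {x : Fin (k + 1) // x ≠ 0} => x.1.pred x.2 := by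
    funext x
    obtain ⟨x, hx⟩ := x
    obtain ⟨j, rfl⟩ := Fin.exists_succ_eq.2 hx
    simp
  rw [e]
  exact h

/-- The cone `o v₀ … v_{k-1}` over the simplex, with apex the origin `o` of `ℝ^(d+1)`. -/
def cone (σ : SphericalSimplex d k) :
    Affine.Simplex ℝ (EuclideanSpace ℝ (Fin (d + 1))) k where
  points := Fin.cons 0 σ.vertex
  independent := σ.affineIndependent_cone

/-- The circumcenter `o'` in `ℝ^(d+1)` of the cone over a spherical `d`-simplex. -/
def coneCircumcenter (σ : SphericalSimplex d (d + 1)) : EuclideanSpace ℝ (Fin (d + 1)) :=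
  σ.cone.circumcenter

/-- The oriented volume of the cone over an ordered spherical `d`-simplex: its Lebesgue measure,
with the sign of the determinant of `(v₀, …, v_d)`. -/
def coneVolume (σ : SphericalSimplex d (d + 1)) : ℝ :=
  Real.sign (Matrix.det (Matrix.of fun i j => σ.vertex i j)) *
    MeasureTheory.volume.real (convexHull ℝ (Set.range σ.cone.points))

/-- The position on the sphere of the weighted circumcenter: `o' / ‖o'‖`. -/
def circumcenterPoint (σ : SphericalSimplex d (d + 1)) : EuclideanSpace ℝ (Fin (d + 1)) :=
  ‖σ.coneCircumcenter‖⁻¹ • σ.coneCircumcenter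

/-- The weight of the weighted circumcenter: `Vol(cone) * ‖o'‖`. -/
def circumcenterWeight (σ : SphericalSimplex d (d + 1)) : ℝ :=
  σ.coneVolume * ‖σ.coneCircumcenter‖

end SphericalSimplex

/-- Finite integer combinations of ordered spherical simplices with `k` vertices in `S^d`. Each
oriented simplicial chain is represented by such a combination. -/
abbrev SphericalChain (d k : ℕ) : Type := SphericalSimplex d k →₀ ℤ

/-- The relations that turn ordered simplices into oriented ones: permuting the vertices
multiplies a simplex by the sign of the permutation. -/
def orientationRelations (d k : ℕ) : AddSubgroup (SphericalChain d k) :=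
  AddSubgroup.closure
    {r | ∃ (σ : SphericalSimplex d k) (π : Equiv.Perm (Fin k)),
      r = Finsupp.single (σ.permute π) 1 - Finsupp.single σ (Equiv.Perm.sign π : ℤ)}

/-- The group of oriented simplicial chains. -/
abbrev OrientedSphericalChain (d k : ℕ) : Type :=
  SphericalChain d k ⧸ orientationRelations d k

namespace SphericalChain

variable {d k : ℕ}

/-- The simplicial boundary `∑ᵢ (-1)ⁱ [v₀ … v̂ᵢ … v_k]`, extended linearly, as an oriented chain.
On points (`k = 0`) this is the augmentation: the only simplex without vertices is the empty one. -/
def boundary (c : SphericalChain d (k + 1)) : OrientedSphericalChain d k :=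
  QuotientAddGroup.mk
    (c.sum fun σ a => ∑ i : Fin (k + 1), Finsupp.single (σ.face i) (a * (-1) ^ (i : ℕ)))

/-- A simplicial cycle: a chain with zero boundary. -/
def IsCycle (c : SphericalChain d (k + 1)) : Prop := c.boundary = 0

/-- A weighted point `(x, m)` is interpreted as the vector `m x`; this is the sum, over the
simplices of the chain (with multiplicity), of the weighted circumcenters. It is the spherical
circumcenter of mass of the chain, as a vector: its direction is the position of the centroid
(defined when it is nonzero), and its norm is the total mass. -/
def circumcenterOfMass (c : SphericalChain d (d + 1)) : EuclideanSpace ℝ (Fin (d + 1)) :=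
  c.sum fun σ a => (a : ℝ) • (σ.circumcenterWeight • σ.circumcenterPoint)

/-- The total mass (weight) of the spherical circumcenter of mass. -/
def circumcenterTotalMass (c : SphericalChain d (d + 1)) : ℝ := ‖c.circumcenterOfMass‖

end SphericalChain

end

/-! The circumcenter `o'` of a cone is equidistant from the origin and from the unit vectors `vᵢ`,
so it solves the linear system `⟨vᵢ, o'⟩ = 1/2`. By Cramer's rule, `det(v) * o'ⱼ` is an alternating
sum of maximal minors, one for each face (`det_mul_coneCircumcenter`). Since `Vol` is `det(v)` times
a constant depending only on `d` (`coneVolume_eq_det_mul`), the vector `Vol • o'` is an additive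
function of the boundary. The minors change by the sign under permutations, so this function is well
defined on oriented chains and vanishes on cycles. -/

namespace SphericalSimplex

variable {d : ℕ}

/-- The matrix whose rows are the vertices of a spherical `d`-simplex. -/
def vertexMatrix (σ : SphericalSimplex d (d + 1)) : Matrix (Fin (d + 1)) (Fin (d + 1)) ℝ :=
  Matrix.of fun i j => σ.vertex i j

/-- The minor of the vertices of a spherical `(d - 1)`-simplex that omits the `j`-th coordinate. -/
def coordMinor (j : Fin (d + 1)) (τ : SphericalSimplex d d) : ℝ :=
  Matrix.det (Matrix.of fun a b => τ.vertex a (j.succAbove b))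

theorem coordMinor_permute (j : Fin (d + 1)) (τ : SphericalSimplex d d)
    (π : Equiv.Perm (Fin d)) :
    coordMinor j (τ.permute π) = ((Equiv.Perm.sign π : ℤ) : ℝ) * coordMinor j τ :=
  Matrix.det_permute π (Matrix.of fun a b => τ.vertex a (j.succAbove b))

theorem two_mul_inner_vertex_coneCircumcenter (σ : SphericalSimplex d (d + 1))
    (i : Fin (d + 1)) : 2 * inner ℝ (σ.vertex i) σ.coneCircumcenter = 1 := by
  have h : dist (σ.vertex i) σ.coneCircumcenter = dist 0 σ.coneCircumcenter :=
    (σ.cone.dist_circumcenter_eq_circumradius i.succ).trans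
      (σ.cone.dist_circumcenter_eq_circumradius 0).symm
  rw [dist_eq_norm, dist_eq_norm, zero_sub, norm_neg] at h
  -- In the expansion of `‖v - o'‖² = ‖o'‖²`, the term `‖o'‖²` cancels and `‖v‖² = 1` remains.
  have h2 := norm_sub_sq_real (σ.vertex i) σ.coneCircumcenter
  rw [h, σ.norm_vertex] at h2
  linarith

theorem vertexMatrix_mulVec_coneCircumcenter (σ : SphericalSimplex d (d + 1)) :
    σ.vertexMatrix.mulVec σ.coneCircumcenter.ofLp = fun _ => (1 / 2 : ℝ) := by
  funext i
  have h := σ.two_mul_inner_vertex_coneCircumcenter i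
  simp only [PiLp.inner_apply, RCLike.inner_apply, conj_trivial] at h
  simp only [Matrix.mulVec, dotProduct, vertexMatrix, Matrix.of_apply]
  simp only [mul_comm (σ.vertex i _)]
  linarith

/-- Cramer's rule for the circumcenter of the cone, expanded along the faces. -/
theorem det_mul_coneCircumcenter (σ : SphericalSimplex d (d + 1)) (j : Fin (d + 1)) :
    σ.vertexMatrix.det * σ.coneCircumcenter j =
      (1 / 2) * (-1) ^ (j : ℕ) * ∑ i : Fin (d + 1), (-1) ^ (i : ℕ) * coordMinor j (σ.face i) := by
  have h := congrArg (fun v => σ.vertexMatrix.adjugate.mulVec v j)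
    σ.vertexMatrix_mulVec_coneCircumcenter
  simp only [Matrix.mulVec_mulVec, Matrix.adjugate_mul, Matrix.smul_mulVec, Matrix.one_mulVec,
    Pi.smul_apply, smul_eq_mul] at h
  rw [h, Matrix.mulVec, dotProduct, Finset.mul_sum]
  refine Finset.sum_congr rfl fun i _ => ?_
  rw [Matrix.adjugate_fin_succ_eq_det_submatrix]
  -- Deleting row `i` of the vertex matrix is passing to the `i`-th face.
  change (-1) ^ ((i : ℕ) + j) * coordMinor j (σ.face i) * (1 / 2) = _
  ring

/-- The simplex with vertices the origin and the standard basis vectors. -/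
def standardCone (d : ℕ) : Set (EuclideanSpace ℝ (Fin (d + 1))) :=
  convexHull ℝ (Set.range (Fin.cons 0 fun i => EuclideanSpace.basisFun (Fin (d + 1)) ℝ i :
    Fin (d + 2) → EuclideanSpace ℝ (Fin (d + 1))))

/-- The linear map sending the standard basis to the vertices carries the standard cone to this one.
The value of the standard volume is never needed. -/
theorem volume_convexHull_cone (σ : SphericalSimplex d (d + 1)) :
    MeasureTheory.volume.real (convexHull ℝ (Set.range σ.cone.points)) =
      |σ.vertexMatrix.det| * MeasureTheory.volume.real (standardCone d) := by
  set b := (EuclideanSpace.basisFun (Fin (d + 1)) ℝ).toBasis with hb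
  set L := Matrix.toLin b b σ.vertexMatrix.transpose with hL
  have hLb (i : Fin (d + 1)) : L (EuclideanSpace.basisFun (Fin (d + 1)) ℝ i) = σ.vertex i := by
    have h := Matrix.toLin_self b b σ.vertexMatrix.transpose i
    rw [← hL, hb, OrthonormalBasis.coe_toBasis] at h
    rw [h]
    exact (EuclideanSpace.basisFun (Fin (d + 1)) ℝ).sum_repr (σ.vertex i)
  have himage : L '' standardCone d = convexHull ℝ (Set.range σ.cone.points) := by
    rw [standardCone, LinearMap.image_convexHull, ← Set.range_comp]
    congr 2
    funext i
    refine Fin.cases ?_ (fun i => ?_) i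
    · exact map_zero L
    · exact hLb i
  rw [← himage, MeasureTheory.measureReal_def, MeasureTheory.Measure.addHaar_image_linearMap,
    ENNReal.toReal_mul, ENNReal.toReal_ofReal (abs_nonneg _), hL, LinearMap.det_toLin,
    Matrix.det_transpose, MeasureTheory.measureReal_def]

theorem coneVolume_eq_det_mul (σ : SphericalSimplex d (d + 1)) :
    σ.coneVolume = σ.vertexMatrix.det * MeasureTheory.volume.real (standardCone d) := by
  rw [coneVolume, volume_convexHull_cone, ← mul_assoc]
  congr 1
  change Real.sign σ.vertexMatrix.det * |σ.vertexMatrix.det| = _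
  rcases lt_trichotomy σ.vertexMatrix.det 0 with h | h | h
  · rw [Real.sign_of_neg h, abs_of_neg h]; ring
  · simp [h]
  · rw [Real.sign_of_pos h, abs_of_pos h, one_mul]

theorem circumcenterWeight_smul_circumcenterPoint (σ : SphericalSimplex d (d + 1)) :
    σ.circumcenterWeight • σ.circumcenterPoint = σ.coneVolume • σ.coneCircumcenter := by
  rw [circumcenterWeight, circumcenterPoint, mul_smul]
  congr 1
  by_cases h : σ.coneCircumcenter = 0
  · simp [h]
  · exact smul_inv_smul₀ (norm_ne_zero_iff.2 h) _

end SphericalSimplex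

namespace SphericalChain

variable {d : ℕ}

open SphericalSimplex

/-- The additive extension of `SphericalSimplex.coordMinor` to chains. -/
noncomputable def coordMinorHom (j : Fin (d + 1)) : SphericalChain d d →+ ℝ :=
  Finsupp.liftAddHom fun τ => (AddMonoidHom.mulRight (coordMinor j τ)).comp (Int.castAddHom ℝ)

@[simp]
theorem coordMinorHom_single (j : Fin (d + 1)) (τ : SphericalSimplex d d) (a : ℤ) :
    coordMinorHom j (Finsupp.single τ a) = a * coordMinor j τ := by
  simp [coordMinorHom]

/-- Determinants alternate in their rows, so the functional descends to oriented chains. For `d = 0`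
the empty minor is `1` and the functional is the augmentation. -/
theorem orientationRelations_le_ker_coordMinorHom (j : Fin (d + 1)) :
    orientationRelations d d ≤ (coordMinorHom j).ker := by
  rw [orientationRelations, AddSubgroup.closure_le]
  rintro _ ⟨τ, π, rfl⟩
  change coordMinorHom j _ = 0
  rw [map_sub, coordMinorHom_single, coordMinorHom_single, coordMinor_permute]
  simp

/-- The circumcenter of mass factors through the boundary. -/
theorem circumcenterOfMass_apply (c : SphericalChain d (d + 1)) (j : Fin (d + 1)) :
    c.circumcenterOfMass j =
      MeasureTheory.volume.real (standardCone d) * ((1 / 2) * (-1) ^ (j : ℕ)) *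
        coordMinorHom j (c.sum fun σ a =>
          ∑ i : Fin (d + 1), Finsupp.single (σ.face i) (a * (-1) ^ (i : ℕ))) := by
  rw [circumcenterOfMass, Finsupp.sum, Finsupp.sum, map_sum, WithLp.ofLp_sum, Finset.sum_apply,
    Finset.mul_sum]
  refine Finset.sum_congr rfl fun σ _ => ?_
  rw [circumcenterWeight_smul_circumcenterPoint, coneVolume_eq_det_mul, map_sum]
  simp only [PiLp.smul_apply, smul_eq_mul, coordMinorHom_single]
  rw [mul_right_comm σ.vertexMatrix.det, det_mul_coneCircumcenter]
  push_cast
  simp only [mul_assoc, ← Finset.mul_sum]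
  ring

end SphericalChain

theorem mainTheorem6 (d : ℕ) (c : SphericalChain d (d + 1)) (hc : c.IsCycle) :
    c.circumcenterOfMass = 0 ∧ c.circumcenterTotalMass = 0 := by
  have h : c.circumcenterOfMass = 0 := by
    ext j
    have hmem := (QuotientAddGroup.eq_zero_iff _).1 hc
    have hzero := SphericalChain.orientationRelations_le_ker_coordMinorHom j hmem
    rw [SphericalChain.circumcenterOfMass_apply, AddMonoidHom.mem_ker.1 hzero, mul_zero]
    rfl
  exact ⟨h, by rw [SphericalChain.circumcenterTotalMass, h, norm_zero]⟩
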